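/- Let $p\in(0,1)$ and let $X$ be a symmetric real random variable (i.e. $X$ and $-X$ have the same distribution) with variance $\sigma^2$ that is sub-gaussian, i.e. $\sup_{q\ge 1} q^{-1/2}\,(\mathbb{E}|X|^q)^{1/q}<\infty$. For each $n$ let $G$ be an Erdős–Rényi–Gilbert random graph $\mathcal{G}(n,p)$ on $n$ labeled vertices (each pair of distinct vertices is joined by an edge independently with probability $p$), let $\lambda_1\ge\lambda_2\ge\cdots\ge\lambda_n$ be the eigenvalues, with multiplicity, of its adjacency matrix, and let $X_1,\dots,X_n$ be i.i.d. random variables with the distribution of $X$, independent of $G$. Then, as $n\to\infty$, $$W_n(\boldsymbol{\lambda})=\frac1n\sum_{i=1}^n\lambda_iX_i\;\longrightarrow\;pX+N_p\quad\text{in distribution},$$ where $N_p$ is a normal random variable, independent of $pX$, with mean zero and variance $p(1-p)\sigma^2$. -/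

import Mathlib

open MeasureTheory ProbabilityTheory Filter
open scoped ENNReal

/-- The sub-gaussian norm `sup_{q ≥ 1} q^{-1/2} ‖X‖_q` of a real random variable, the supremum being
over real `q ≥ 1`, as an extended nonnegative real. -/
noncomputable def subGaussianNorm {Ω : Type*} [MeasurableSpace Ω] (X : Ω → ℝ) (P : Measure Ω) :
    ℝ≥0∞ :=
  ⨆ (q : ℝ) (_ : 1 ≤ q), ENNReal.ofReal (q ^ (-(1 / 2) : ℝ)) * eLpNorm X (ENNReal.ofReal q) P

/-- A real random variable is sub-gaussian if its sub-gaussian norm is finite. -/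
def IsSubGaussian {Ω : Type*} [MeasurableSpace Ω] (X : Ω → ℝ) (P : Measure Ω) : Prop :=
  AEMeasurable X P ∧ subGaussianNorm X P < ∞

/-- A real random variable `X` is symmetric if `X` and `-X` have the same law. -/
def IsSymmetricRV {Ω : Type*} [MeasurableSpace Ω] (X : Ω → ℝ) (P : Measure Ω) : Prop :=
  IdentDistrib X (fun ω => -X ω) P P

open Classical in
theorem adjMatrix_isHermitian {n : ℕ} (G : SimpleGraph (Fin n)) :
    (G.adjMatrix ℝ).IsHermitian := by
  rw [Matrix.IsHermitian, Matrix.conjTranspose_eq_transpose_of_trivial]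
  exact G.isSymm_adjMatrix

open Classical in
/-- The eigenvalues, with multiplicity, of the adjacency matrix of a graph on `n` labeled vertices,
in non-increasing order. -/
noncomputable def graphEigenvalues {n : ℕ} (G : SimpleGraph (Fin n)) (i : Fin n) : ℝ :=
  (adjMatrix_isHermitian G).eigenvalues₀ (Fin.cast (Fintype.card_fin n).symm i)

/-- The weighted sum `n⁻¹ (a₁ x₁ + ⋯ + aₙ xₙ)`. -/
noncomputable def weightedSum {n : ℕ} (a x : Fin n → ℝ) : ℝ :=
  (n : ℝ)⁻¹ * ∑ i, a i * x i

/-! Let `φ` be the characteristic function of `X` and `aᵢ = λᵢ / n`. Given the graph, `W_n` has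
characteristic function `∏ φ(t aᵢ)`. One `aᵢ` is close to `p`. The others are small, with squares
summing to about `p - p²`, so symmetry and a fourth moment make their factors multiply to a
Gaussian: the limit is `φ(tp) exp(-σ² t² (p - p²) / 2)`, and Lévy's continuity theorem concludes.

No concentration or eigenvalue asymptotics are needed. With `D = ∑ aᵢ²` and `S = ∑ aᵢ⁴`, the
Rayleigh quotient of the all-ones vector gives some `aᵢ ≥ D` (`exists_le_graphEigenvalues`), hence
`S ≥ D⁴`. On average `D` is nearly `p`, and `S` is at most about `p⁴` by counting closed 4-walks;
this near-equality forces the picture above. `exists_norm_prod_sub_le` bounds the error by an affine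
function of `S` and `D`, so the two expectations suffice. -/

/-! ### Elementary inequalities. -/

theorem norm_prod_sub_prod_le_sum_norm_sub {ι : Type*} (s : Finset ι) (f g : ι → ℂ)
    (hf : ∀ i ∈ s, ‖f i‖ ≤ 1) (hg : ∀ i ∈ s, ‖g i‖ ≤ 1) :
    ‖∏ i ∈ s, f i - ∏ i ∈ s, g i‖ ≤ ∑ i ∈ s, ‖f i - g i‖ := by
  classical
  induction s using Finset.induction_on with
  | empty => simp
  | insert a s ha ih =>
    rw [Finset.prod_insert ha, Finset.prod_insert ha, Finset.sum_insert ha]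
    have h1 := ih (fun i hi => hf i (Finset.mem_insert_of_mem hi))
      (fun i hi => hg i (Finset.mem_insert_of_mem hi))
    have h2 : ‖∏ i ∈ s, g i‖ ≤ 1 := by
      rw [norm_prod]
      exact Finset.prod_le_one (fun _ _ => norm_nonneg _)
        (fun i hi => hg i (Finset.mem_insert_of_mem hi))
    have h3 := hf a (Finset.mem_insert_self a s)
    have : f a * ∏ i ∈ s, f i - g a * ∏ i ∈ s, g i
        = f a * (∏ i ∈ s, f i - ∏ i ∈ s, g i) + (f a - g a) * ∏ i ∈ s, g i := by ring
    rw [this]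
    refine (norm_add_le _ _).trans ?_
    rw [norm_mul, norm_mul]
    nlinarith [norm_nonneg (f a - g a), norm_nonneg (∏ i ∈ s, f i - ∏ i ∈ s, g i)]

theorem abs_exp_neg_sub_exp_neg_le {x y : ℝ} (hx : 0 ≤ x) (hy : 0 ≤ y) :
    |Real.exp (-x) - Real.exp (-y)| ≤ |x - y| := by
  wlog h : x ≤ y generalizing x y
  · rw [abs_sub_comm, abs_sub_comm x]
    exact this hy hx (le_of_not_ge h)
  have h1 : Real.exp (-y) = Real.exp (-x) * Real.exp (-(y - x)) := by
    rw [← Real.exp_add]; ring_nf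
  have h2 := Real.add_one_le_exp (-(y - x))
  have h3 : Real.exp (-x) ≤ 1 := Real.exp_le_one_iff.2 (by linarith)
  have h4 : Real.exp (-y) ≤ Real.exp (-x) := Real.exp_le_exp.2 (by linarith)
  rw [abs_of_nonneg (by linarith), abs_of_nonpos (by linarith), h1]
  nlinarith [Real.exp_pos (-x)]

theorem abs_exp_neg_sub_one_add_le {x : ℝ} (hx : 0 ≤ x) :
    |Real.exp (-x) - (1 - x)| ≤ x ^ 2 := by
  have h1 := Real.add_one_le_exp (-x)
  rw [abs_of_nonneg (by linarith)]
  have h2 : Real.exp (-x) ≤ 1 / (1 + x) := by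
    rw [Real.exp_neg, ← one_div]
    exact one_div_le_one_div_of_le (by linarith) (by linarith [Real.add_one_le_exp x])
  have h3 : 1 / (1 + x) ≤ 1 - x + x ^ 2 := by
    rw [div_le_iff₀ (by linarith)]
    nlinarith [pow_nonneg hx 3]
  linarith

/-- Taylor for `|x| ≤ 1`; for `|x| ≥ 1` the crude bounds on cosine suffice, as `1 ≤ x² ≤ x⁴`. Being
global, it can be integrated without truncation. -/
theorem abs_cos_sub_le (x : ℝ) : |Real.cos x - (1 - x ^ 2 / 2)| ≤ 3 * x ^ 4 := by
  rcases le_total |x| 1 with h | h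
  · refine (Real.cos_bound h).trans ?_
    rw [show |x| ^ 4 = x ^ 4 from Even.pow_abs (by decide) x]
    nlinarith [pow_nonneg (sq_nonneg x) 2]
  · have h1 : 1 ≤ x ^ 2 := by rw [← sq_abs]; nlinarith
    rw [abs_le]
    constructor <;> nlinarith [Real.cos_le_one x, Real.neg_one_le_cos x]

/-! ### Products of characteristic functions with one dominant argument. -/

section Deterministic

variable {ι : Type*} [Fintype ι]

/-- A product of values of a function that agrees with a Gaussian up to fourth order is, up to the
fourth moments of the other arguments, one factor times a Gaussian factor. -/
theorem norm_prod_sub_mul_exp_le {φ : ℝ → ℂ} {v C B : ℝ} (hv : 0 ≤ v) (hC : 0 ≤ C)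
    (hφ1 : ∀ s, ‖φ s‖ ≤ 1)
    (hφ : ∀ s, ‖φ s - (Real.exp (-(v * s ^ 2 / 2)) : ℝ)‖ ≤ C * s ^ 4)
    (hφB : ∀ s s', ‖φ s - φ s'‖ ≤ B * |s - s'|)
    {p : ℝ} (hp0 : 0 ≤ p) (hp1 : p ≤ 1) (t : ℝ) (a : ι → ℝ) (i₀ : ι) {D : ℝ}
    (hD0 : 0 ≤ D) (hD1 : D ≤ 1) (hD : ∑ i, a i ^ 2 = D) (hi : D ≤ a i₀) :
    ‖∏ i, φ (t * a i) - φ (t * p) * (Real.exp (-(v * t ^ 2 * (p - p ^ 2) / 2)) : ℝ)‖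
      ≤ C * t ^ 4 * (∑ i, a i ^ 4 - D ^ 4) + (B * |t| + v * t ^ 2) * |a i₀ - p|
        + v * t ^ 2 / 2 * |D - p| := by
  classical
  have ha0 : 0 ≤ a i₀ := hD0.trans hi
  have hsq : a i₀ ^ 2 + ∑ i ∈ Finset.univ.erase i₀, a i ^ 2 = D := by
    rw [← hD, Finset.add_sum_erase _ (fun i => a i ^ 2) (Finset.mem_univ i₀)]
  have hfour : a i₀ ^ 4 + ∑ i ∈ Finset.univ.erase i₀, a i ^ 4 = ∑ i, a i ^ 4 :=
    Finset.add_sum_erase _ (fun i => a i ^ 4) (Finset.mem_univ i₀)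
  have hrest : ∑ i ∈ Finset.univ.erase i₀, a i ^ 2 = D - a i₀ ^ 2 := by linarith
  have hrest0 : 0 ≤ D - a i₀ ^ 2 := hrest ▸ Finset.sum_nonneg fun i _ => sq_nonneg (a i)
  have ha1 : a i₀ ≤ 1 := by nlinarith
  -- Hence the arguments other than `a i₀` have fourth powers summing to at most `S - D⁴`.
  have hD4 : D ^ 4 ≤ a i₀ ^ 4 := pow_le_pow_left₀ hD0 hi 4
  have hnorm : ∀ x : ℝ, 0 ≤ x → ‖((Real.exp (-x) : ℝ) : ℂ)‖ ≤ 1 := by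
    intro x hx
    rw [Complex.norm_real, Real.norm_of_nonneg (Real.exp_pos _).le]
    exact Real.exp_le_one_iff.2 (by linarith)
  have hexp : ∏ i ∈ Finset.univ.erase i₀, ((Real.exp (-(v * (t * a i) ^ 2 / 2)) : ℝ) : ℂ)
      = (Real.exp (-(v * t ^ 2 * (D - a i₀ ^ 2) / 2)) : ℝ) := by
    rw [← Complex.ofReal_prod, ← Real.exp_sum, ← hrest, Finset.sum_neg_distrib, Finset.mul_sum,
      Finset.sum_div]
    congr 3
    exact Finset.sum_congr rfl fun i _ => by ring
  have h1 : ‖∏ i ∈ Finset.univ.erase i₀, φ (t * a i)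
      - (Real.exp (-(v * t ^ 2 * (D - a i₀ ^ 2) / 2)) : ℝ)‖
      ≤ C * t ^ 4 * (∑ i, a i ^ 4 - D ^ 4) := by
    rw [← hexp]
    refine (norm_prod_sub_prod_le_sum_norm_sub _ _ _ (fun i _ => hφ1 _)
      (fun i _ => hnorm _ (by positivity))).trans ?_
    refine (Finset.sum_le_sum fun i _ => hφ (t * a i)).trans ?_
    simp_rw [mul_pow, ← mul_assoc]
    rw [← Finset.mul_sum]
    gcongr
    linarith
  have h2 : ‖φ (t * a i₀) - φ (t * p)‖ ≤ B * |t| * |a i₀ - p| := by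
    refine (hφB _ _).trans_eq ?_
    rw [← mul_sub, abs_mul, mul_assoc]
  have h3 : ‖((Real.exp (-(v * t ^ 2 * (D - a i₀ ^ 2) / 2)) : ℝ) : ℂ)
      - (Real.exp (-(v * t ^ 2 * (p - p ^ 2) / 2)) : ℝ)‖
      ≤ v * t ^ 2 / 2 * |D - p| + v * t ^ 2 * |a i₀ - p| := by
    rw [← Complex.ofReal_sub, Complex.norm_real, Real.norm_eq_abs]
    refine (abs_exp_neg_sub_exp_neg_le (by positivity)
      (by have : 0 ≤ p - p ^ 2 := by nlinarith
          positivity)).trans ?_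
    have e : v * t ^ 2 * (D - a i₀ ^ 2) / 2 - v * t ^ 2 * (p - p ^ 2) / 2
      = v * t ^ 2 / 2 * ((D - p) - (a i₀ - p) * (a i₀ + p)) := by ring
    rw [e, abs_mul, abs_of_nonneg (by positivity : 0 ≤ v * t ^ 2 / 2)]
    have h4 : |(D - p) - (a i₀ - p) * (a i₀ + p)| ≤ |D - p| + 2 * |a i₀ - p| := by
      refine (abs_sub _ _).trans ?_
      rw [abs_mul, abs_of_nonneg (by linarith : 0 ≤ a i₀ + p)]
      nlinarith [abs_nonneg (a i₀ - p)]
    have h5 : 0 ≤ v * t ^ 2 / 2 := by positivity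
    nlinarith
  rw [← Finset.mul_prod_erase _ _ (Finset.mem_univ i₀)]
  set E := ((Real.exp (-(v * t ^ 2 * (D - a i₀ ^ 2) / 2)) : ℝ) : ℂ) with hE
  set E' := ((Real.exp (-(v * t ^ 2 * (p - p ^ 2) / 2)) : ℝ) : ℂ) with hE'
  set Q := ∏ i ∈ Finset.univ.erase i₀, φ (t * a i)
  have hE1 : ‖E‖ ≤ 1 := hnorm _ (by positivity)
  -- Replace in turn the remaining product by its Gaussian, `a i₀` by `p`, and the variance by its
  -- limit; all factors have norm at most 1.
  have e : φ (t * a i₀) * Q - φ (t * p) * E'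
      = φ (t * a i₀) * (Q - E) + (φ (t * a i₀) - φ (t * p)) * E + φ (t * p) * (E - E') := by ring
  rw [e]
  refine (norm_add₃_le).trans ?_
  rw [norm_mul, norm_mul, norm_mul]
  have g1 := mul_le_of_le_one_left (norm_nonneg (Q - E)) (hφ1 (t * a i₀))
  have g2 := mul_le_of_le_one_right (norm_nonneg (φ (t * a i₀) - φ (t * p))) hE1
  have g3 := mul_le_of_le_one_left (norm_nonneg (E - E')) (hφ1 (t * p))
  linarith

/-- This bound and the next trade a first power for a small constant plus a higher power, which is
controlled by an affine expression in `S` and `D`. -/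
theorem le_add_pow_four_div {x ε : ℝ} (hx : 0 ≤ x) (hε : 0 < ε) : x ≤ ε + x ^ 4 / ε ^ 3 := by
  rcases le_total x ε with h | h
  · have : 0 ≤ x ^ 4 / ε ^ 3 := by positivity
    linarith
  · have : x ≤ x ^ 4 / ε ^ 3 := by
      rw [le_div_iff₀ (by positivity)]
      have := pow_le_pow_left₀ hε.le h 3
      nlinarith
    linarith

theorem abs_le_add_sq_div (x : ℝ) {ε : ℝ} (hε : 0 < ε) : |x| ≤ ε + x ^ 2 / ε := by
  rcases le_total |x| ε with h | h
  · have : 0 ≤ x ^ 2 / ε := by positivity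
    linarith
  · have : |x| ≤ x ^ 2 / ε := by
      rw [le_div_iff₀ hε, ← sq_abs]
      nlinarith [abs_nonneg x]
    linarith

/-- If `∑ aᵢ²` is dominated by a single `aᵢ`, then `∏ φ(t aᵢ)` is close to
`φ(tp) exp(-v t² (p - p²) / 2)` as soon as `∑ aᵢ²` is close to `p` and `∑ aᵢ⁴` to `p⁴`; the error
is affine in these two sums, so that it can be averaged. -/
theorem exists_norm_prod_sub_le {φ : ℝ → ℂ} {v C B : ℝ} (hv : 0 ≤ v) (hC : 0 ≤ C) (hB : 0 ≤ B)
    (hφ1 : ∀ s, ‖φ s‖ ≤ 1)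
    (hφ : ∀ s, ‖φ s - (Real.exp (-(v * s ^ 2 / 2)) : ℝ)‖ ≤ C * s ^ 4)
    (hφB : ∀ s s', ‖φ s - φ s'‖ ≤ B * |s - s'|)
    {p : ℝ} (hp0 : 0 < p) (hp1 : p ≤ 1) (t : ℝ) {ε : ℝ} (hε : 0 < ε) :
    ∃ L M : ℝ, 0 ≤ L ∧ 0 ≤ M ∧ ∀ (n : ℕ) (a : Fin n → ℝ) (i₀ : Fin n),
      ∑ i, a i ^ 2 ≤ 1 → ∑ i, a i ^ 2 ≤ a i₀ →
      ‖∏ i, φ (t * a i) - φ (t * p) * (Real.exp (-(v * t ^ 2 * (p - p ^ 2) / 2)) : ℝ)‖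
        ≤ ε + L * (∑ i, a i ^ 4 - p ^ 4) + M * (p - ∑ i, a i ^ 2) := by
  set K := 2 * (B * |t| + v * t ^ 2) + v * t ^ 2 / 2 + 1 with hK
  have hKpos : 0 < K := by positivity
  set K₁ := B * |t| + v * t ^ 2 with hK₁
  have hK₁0 : 0 ≤ K₁ := by positivity
  set K₂ := K₁ + v * t ^ 2 / 2 with hK₂
  have hK₂0 : 0 ≤ K₂ := by positivity
  set δ := ε / K with hδ
  have hδ0 : 0 < δ := by positivity
  have hC' : 0 ≤ C * t ^ 4 + K₁ / δ ^ 3 := by positivity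
  -- The coefficients of `S - p⁴` and `p - D` collected in the final `calc`.
  refine ⟨C * t ^ 4 + K₁ / δ ^ 3 + K₂ / δ / (2 * p ^ 2),
    (C * t ^ 4 + K₁ / δ ^ 3) * (4 * p ^ 3) + K₂ / δ * (2 * p), by positivity, by positivity, ?_⟩
  intro n a i₀ h1 hi
  set D := ∑ i, a i ^ 2 with hD
  set S := ∑ i, a i ^ 4 with hS
  have hD0 : 0 ≤ D := Finset.sum_nonneg fun i _ => sq_nonneg (a i)
  have key := norm_prod_sub_mul_exp_le hv hC hφ1 hφ hφB hp0.le hp1 t a i₀ hD0 h1 rfl hi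
  refine key.trans ?_
  rw [← hK₁, ← hS]
  have hSa : a i₀ ^ 4 ≤ S :=
    Finset.single_le_sum (f := fun i => a i ^ 4) (fun i _ => by positivity) (Finset.mem_univ i₀)
  have htri : |a i₀ - p| ≤ (a i₀ - D) + |D - p| := by
    have := abs_sub_le (a i₀) D p
    rwa [abs_of_nonneg (sub_nonneg.2 hi)] at this
  -- Superadditivity of `x⁴` on nonnegative reals, for `a i₀ = (a i₀ - D) + D`.
  have hsuper : (a i₀ - D) ^ 4 ≤ S - D ^ 4 := by
    have hd := sub_nonneg.2 hi
    have : a i₀ ^ 4 = ((a i₀ - D) + D) ^ 4 := by ring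
    have h5 : (a i₀ - D) ^ 4 + D ^ 4 ≤ ((a i₀ - D) + D) ^ 4 := by
      have : 0 ≤ 4 * (a i₀ - D) ^ 3 * D + 6 * (a i₀ - D) ^ 2 * D ^ 2
        + 4 * (a i₀ - D) * D ^ 3 := by positivity
      nlinarith
    linarith
  -- The convex function `x⁴` lies above its tangent at `p`.
  have htangent : S - D ^ 4 ≤ (S - p ^ 4) + 4 * p ^ 3 * (p - D) := by
    have : 0 ≤ (D - p) ^ 2 * ((D + p) ^ 2 + 2 * p ^ 2) := by positivity
    nlinarith
  have hDS : D ^ 4 ≤ S := (pow_le_pow_left₀ hD0 hi 4).trans hSa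
  -- Expand the square and use `2 p² D² ≤ D⁴ + p⁴ ≤ S + p⁴`.
  have hsq : (D - p) ^ 2 ≤ (S - p ^ 4) / (2 * p ^ 2) + 2 * p * (p - D) := by
    have h6 : D ^ 2 ≤ (S + p ^ 4) / (2 * p ^ 2) := by
      rw [le_div_iff₀ (by positivity)]
      nlinarith [sq_nonneg (D ^ 2 - p ^ 2)]
    have h7 : (S + p ^ 4) / (2 * p ^ 2) = (S - p ^ 4) / (2 * p ^ 2) + p ^ 2 := by
      field_simp; ring
    nlinarith
  have hx := le_add_pow_four_div (sub_nonneg.2 hi) hδ0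
  have hy := abs_le_add_sq_div (D - p) hδ0
  have hx' : a i₀ - D ≤ δ + ((S - p ^ 4) + 4 * p ^ 3 * (p - D)) / δ ^ 3 := by
    refine hx.trans ?_
    gcongr
    linarith
  have hy' : |D - p| ≤ δ + ((S - p ^ 4) / (2 * p ^ 2) + 2 * p * (p - D)) / δ := by
    refine hy.trans ?_
    gcongr
  have hKδ : (2 * K₁ + v * t ^ 2 / 2) * δ ≤ ε := by
    have h8 : K * δ = ε := by rw [hδ]; field_simp
    have h9 : (2 * K₁ + v * t ^ 2 / 2) * δ = K * δ - δ := by rw [hK]; ring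
    linarith
  clear_value K₁ K₂ K δ D S
  calc C * t ^ 4 * (S - D ^ 4) + K₁ * |a i₀ - p| + v * t ^ 2 / 2 * |D - p|
      ≤ C * t ^ 4 * (S - D ^ 4) + K₁ * ((a i₀ - D) + |D - p|) + v * t ^ 2 / 2 * |D - p| := by gcongr
    _ = C * t ^ 4 * (S - D ^ 4) + K₁ * (a i₀ - D) + K₂ * |D - p| := by rw [hK₂]; ring
    _ ≤ C * t ^ 4 * ((S - p ^ 4) + 4 * p ^ 3 * (p - D))
        + K₁ * (δ + ((S - p ^ 4) + 4 * p ^ 3 * (p - D)) / δ ^ 3)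
        + K₂ * (δ + ((S - p ^ 4) / (2 * p ^ 2) + 2 * p * (p - D)) / δ) := by gcongr
    _ = (2 * K₁ + v * t ^ 2 / 2) * δ
        + (C * t ^ 4 + K₁ / δ ^ 3 + K₂ / δ / (2 * p ^ 2)) * (S - p ^ 4)
        + ((C * t ^ 4 + K₁ / δ ^ 3) * (4 * p ^ 3) + K₂ / δ * (2 * p)) * (p - D) := by
      rw [hK₂]; ring
    _ ≤ _ := by gcongr

end Deterministic

/-! ### The characteristic function of a symmetric variable. -/

section CharFun

variable {Ω : Type*} [MeasurableSpace Ω] {P : Measure Ω} {X : Ω → ℝ}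

theorem IsSubGaussian.memLp_four (h : IsSubGaussian X P) : MemLp X 4 P := by
  refine ⟨h.1.aestronglyMeasurable, ?_⟩
  have h1 : ENNReal.ofReal ((4 : ℝ) ^ (-(1 / 2) : ℝ)) * eLpNorm X (ENNReal.ofReal 4) P
      ≤ subGaussianNorm X P :=
    le_iSup₂ (f := fun (q : ℝ) (_ : 1 ≤ q) =>
      ENNReal.ofReal (q ^ (-(1 / 2) : ℝ)) * eLpNorm X (ENNReal.ofReal q) P) 4 (by norm_num)
  have h2 := h1.trans_lt h.2
  -- The weight must be nonzero because `0 * ∞ = 0` in `ℝ≥0∞`.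
  have h3 : ENNReal.ofReal ((4 : ℝ) ^ (-(1 / 2) : ℝ)) ≠ 0 := by
    simp only [ne_eq, ENNReal.ofReal_eq_zero, not_le]
    positivity
  have h4 : ENNReal.ofReal (4 : ℝ) = 4 := by norm_num
  rw [h4] at h2
  by_contra hc
  rw [not_lt, top_le_iff] at hc
  rw [hc, ENNReal.mul_top h3] at h2
  exact lt_irrefl _ h2

theorem IsSymmetricRV.integral_odd_eq_zero (h : IsSymmetricRV X P) {f : ℝ → ℝ}
    (hf : Measurable f) (hodd : ∀ x, f (-x) = -f x) : ∫ ω, f (X ω) ∂P = 0 := by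
  have h1 : ∫ ω, f (X ω) ∂P = ∫ ω, f (-X ω) ∂P := (h.comp hf).integral_eq
  simp_rw [hodd, integral_neg] at h1
  linarith

variable [IsProbabilityMeasure P]

theorem IsSymmetricRV.charFun_eq (h : IsSymmetricRV X P) (s : ℝ) :
    charFun (P.map X) s = ((∫ ω, Real.cos (s * X ω) ∂P : ℝ) : ℂ) := by
  have hX : AEMeasurable X P := h.aemeasurable_fst
  have hs := h.integral_odd_eq_zero (f := fun x => Real.sin (s * x)) (by fun_prop)
    (fun x => by simp [mul_neg, Real.sin_neg])
  rw [charFun_apply_real, integral_map hX (by fun_prop)]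
  have e : ∀ ω, Complex.exp (s * X ω * Complex.I)
      = (Real.cos (s * X ω) : ℂ) + (Real.sin (s * X ω) : ℂ) * Complex.I := by
    intro ω
    rw [Complex.exp_mul_I]; push_cast; rfl
  simp_rw [e]
  have i1 : Integrable (fun ω => (Real.cos (s * X ω) : ℂ)) P :=
    Integrable.of_bound (by fun_prop) 1
      (ae_of_all _ fun ω => by
        rw [Complex.norm_real, Real.norm_eq_abs]; exact Real.abs_cos_le_one _)
  have i2 : Integrable (fun ω => (Real.sin (s * X ω) : ℂ)) P :=
    Integrable.of_bound (by fun_prop) 1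
      (ae_of_all _ fun ω => by
        rw [Complex.norm_real, Real.norm_eq_abs]; exact Real.abs_sin_le_one _)
  rw [integral_add i1 (i2.mul_const _), integral_mul_const, integral_complex_ofReal,
    integral_complex_ofReal, hs]
  simp

/-- Symmetry leaves only the cosine, so there is no cubic term; both sides are compared with `1 -
Var[X; P] s² / 2`. -/
theorem IsSymmetricRV.norm_charFun_sub_exp_le (h : IsSymmetricRV X P) (h4 : MemLp X 4 P) (s : ℝ) :
    ‖charFun (P.map X) s - (Real.exp (-(Var[X; P] * s ^ 2 / 2)) : ℝ)‖
      ≤ (3 * ∫ ω, X ω ^ 4 ∂P + Var[X; P] ^ 2 / 4) * s ^ 4 := by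
  have hX : AEMeasurable X P := h.aemeasurable_fst
  have h0 : ∫ ω, X ω ∂P = 0 := h.integral_odd_eq_zero (f := fun x => x) measurable_id (fun _ => rfl)
  have hvar : Var[X; P] = ∫ ω, X ω ^ 2 ∂P := variance_of_integral_eq_zero hX h0
  have hv0 : 0 ≤ Var[X; P] := variance_nonneg X P
  have i4 : Integrable (fun ω => X ω ^ 4) P := by
    have := h4.integrable_norm_pow (by norm_num)
    refine this.congr (ae_of_all _ fun ω => ?_)
    simp [Even.pow_abs (by decide : Even 4)]
  have i2 : Integrable (fun ω => X ω ^ 2) P :=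
    (h4.mono_exponent (by norm_num : (2 : ℝ≥0∞) ≤ 4)).integrable_sq
  have ic : Integrable (fun ω => Real.cos (s * X ω)) P :=
    Integrable.of_bound (by fun_prop) 1
      (ae_of_all _ fun ω => by rw [Real.norm_eq_abs]; exact Real.abs_cos_le_one _)
  rw [h.charFun_eq, ← Complex.ofReal_sub, Complex.norm_real, Real.norm_eq_abs]
  have iq : Integrable (fun ω => 1 - s ^ 2 / 2 * X ω ^ 2) P :=
    (integrable_const _).sub (i2.const_mul _)
  have e1 : ∫ ω, (1 - s ^ 2 / 2 * X ω ^ 2) ∂P = 1 - Var[X; P] * s ^ 2 / 2 := by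
    rw [integral_sub (integrable_const _) (i2.const_mul _), integral_const_mul, ← hvar]
    simp; ring
  have b1 : |∫ ω, Real.cos (s * X ω) ∂P - (1 - Var[X; P] * s ^ 2 / 2)|
      ≤ (3 * ∫ ω, X ω ^ 4 ∂P) * s ^ 4 := by
    rw [← e1, ← integral_sub ic iq]
    refine (abs_integral_le_integral_abs).trans ?_
    have e2 : (3 * ∫ ω, X ω ^ 4 ∂P) * s ^ 4 = ∫ ω, 3 * s ^ 4 * X ω ^ 4 ∂P := by
      rw [integral_const_mul]; ring
    rw [e2]
    refine integral_mono (ic.sub iq).abs (i4.const_mul _) fun ω => ?_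
    have := abs_cos_sub_le (s * X ω)
    calc _ = |Real.cos (s * X ω) - (1 - (s * X ω) ^ 2 / 2)| := by
            congr 1; ring
      _ ≤ _ := this
      _ = _ := by ring
  have b2 := abs_exp_neg_sub_one_add_le (x := Var[X; P] * s ^ 2 / 2) (by positivity)
  rw [abs_sub_comm] at b2
  refine (abs_sub_le _ (1 - Var[X; P] * s ^ 2 / 2) _).trans ((add_le_add b1 b2).trans_eq ?_)
  ring

theorem norm_charFun_sub_charFun_le (hX : Integrable X P) (s s' : ℝ) :
    ‖charFun (P.map X) s - charFun (P.map X) s'‖ ≤ (∫ ω, |X ω| ∂P) * |s - s'| := by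
  have hXm : AEMeasurable X P := hX.aemeasurable
  have i : ∀ s : ℝ, Integrable (fun ω => Complex.exp (s * X ω * Complex.I)) P := fun s =>
    Integrable.of_bound (by fun_prop) 1 (ae_of_all _ fun ω => by
      rw [← Complex.ofReal_mul, Complex.norm_exp_ofReal_mul_I])
  rw [charFun_apply_real, charFun_apply_real, integral_map hXm (by fun_prop),
    integral_map hXm (by fun_prop), ← integral_sub (i s) (i s'), ← integral_mul_const]
  refine norm_integral_le_of_norm_le (hX.abs.mul_const _) (ae_of_all _ fun ω => ?_)
  have e : Complex.exp (s * X ω * Complex.I) - Complex.exp (s' * X ω * Complex.I)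
      = Complex.exp (s' * X ω * Complex.I)
        * (Complex.exp (Complex.I * ((s - s') * X ω : ℝ)) - 1) := by
    rw [mul_sub, ← Complex.exp_add]; push_cast; ring_nf
  rw [e, norm_mul, ← Complex.ofReal_mul, Complex.norm_exp_ofReal_mul_I, one_mul]
  refine (Real.norm_exp_I_mul_ofReal_sub_one_le).trans_eq ?_
  rw [norm_mul, mul_comm]; rfl

end CharFun

/-! ### Traces and Rayleigh quotients of Hermitian matrices. -/

section Spectral

variable {m : Type*} [Fintype m] [DecidableEq m] {A : Matrix m m ℝ}

theorem Matrix.IsHermitian.trace_pow_eq_sum_eigenvalues_pow (hA : A.IsHermitian) (k : ℕ) :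
    (A ^ k).trace = ∑ i, hA.eigenvalues i ^ k := by
  conv_lhs => rw [hA.spectral_theorem, ← map_pow, Unitary.conjStarAlgAut_apply, Matrix.trace_mul_comm,
    ← mul_assoc, Unitary.coe_star_mul_self, one_mul, Matrix.diagonal_pow, Matrix.trace_diagonal]
  simp

/-- In an eigenbasis the quadratic form is a sum of eigenvalues weighted by squared coordinates; the
largest eigenvalue serves. -/
theorem Matrix.IsHermitian.exists_dotProduct_mulVec_le (hA : A.IsHermitian) [Nonempty m]
    (x : m → ℝ) : ∃ i, x ⬝ᵥ A.mulVec x ≤ hA.eigenvalues i * (x ⬝ᵥ x) := by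
  obtain ⟨i, -, hi⟩ := Finset.exists_max_image Finset.univ hA.eigenvalues Finset.univ_nonempty
  refine ⟨i, ?_⟩
  set U : Matrix m m ℝ := (hA.eigenvectorUnitary : Matrix m m ℝ) with hU
  have hUU : U * star U = 1 := Unitary.coe_mul_star_self _
  have e1 : x ⬝ᵥ A.mulVec x = ∑ j, hA.eigenvalues j * ((star U).mulVec x j) ^ 2 := by
    conv_lhs => rw [hA.spectral_theorem, Unitary.conjStarAlgAut_apply]
    rw [← hU, ← Matrix.mulVec_mulVec, ← Matrix.mulVec_mulVec, Matrix.dotProduct_mulVec,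
      ← Matrix.mulVec_transpose]
    simp only [dotProduct, Matrix.mulVec_diagonal]
    refine Finset.sum_congr rfl fun j _ => ?_
    rw [Matrix.star_eq_conjTranspose, Matrix.conjTranspose_eq_transpose_of_trivial]
    simp; ring
  have e2 : x ⬝ᵥ x = ∑ j, ((star U).mulVec x j) ^ 2 := by
    have : x ⬝ᵥ x = x ⬝ᵥ (U * star U).mulVec x := by rw [hUU, Matrix.one_mulVec]
    rw [this, ← Matrix.mulVec_mulVec, Matrix.dotProduct_mulVec, ← Matrix.mulVec_transpose]
    simp only [dotProduct]
    refine Finset.sum_congr rfl fun j _ => ?_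
    rw [Matrix.star_eq_conjTranspose, Matrix.conjTranspose_eq_transpose_of_trivial]
    ring
  rw [e1, e2, Finset.mul_sum]
  exact Finset.sum_le_sum fun j _ =>
    mul_le_mul_of_nonneg_right (hi j (Finset.mem_univ _)) (sq_nonneg _)

end Spectral

/-! ### Spectral moments of a graph. -/

section Graph

open Classical in
/-- The indicator of adjacency. -/
noncomputable def adjIndicator {V : Type*} (G : SimpleGraph V) (i j : V) : ℝ :=
  if G.Adj i j then 1 else 0

variable {n : ℕ} (G : SimpleGraph (Fin n))

/-- `eigenvalues` is `eigenvalues₀` reindexed by a bijection that need not respect the order, so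
only symmetric expressions are compared. -/
theorem sum_comp_graphEigenvalues (f : ℝ → ℝ) :
    open Classical in
    ∑ i, f (graphEigenvalues G i) = ∑ i, f ((adjMatrix_isHermitian G).eigenvalues i) := by
  classical
  unfold graphEigenvalues Matrix.IsHermitian.eigenvalues
  exact Fintype.sum_equiv
    ((finCongr (Fintype.card_fin n).symm).trans (Fintype.equivOfCardEq (Fintype.card_fin _))) _ _
    (fun i => by simp)

theorem exists_graphEigenvalues_eq (i : Fin n) :
    open Classical in
    ∃ j, graphEigenvalues G j = (adjMatrix_isHermitian G).eigenvalues i := by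
  classical
  unfold graphEigenvalues Matrix.IsHermitian.eigenvalues
  exact ⟨Fin.cast (Fintype.card_fin n)
    ((Fintype.equivOfCardEq (Fintype.card_fin _)).symm i), rfl⟩

theorem adjIndicator_nonneg {V : Type*} (G : SimpleGraph V) (i j : V) : 0 ≤ adjIndicator G i j := by
  unfold adjIndicator; split_ifs <;> norm_num

theorem adjIndicator_le_one {V : Type*} (G : SimpleGraph V) (i j : V) : adjIndicator G i j ≤ 1 := by
  unfold adjIndicator; split_ifs <;> norm_num

theorem sum_graphEigenvalues_sq :
    ∑ i, graphEigenvalues G i ^ 2 = ∑ i, ∑ j, adjIndicator G i j := by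
  classical
  rw [sum_comp_graphEigenvalues G (· ^ 2),
    ← Matrix.IsHermitian.trace_pow_eq_sum_eigenvalues_pow, Matrix.trace]
  refine Finset.sum_congr rfl fun i _ => ?_
  rw [Matrix.diag_apply, pow_two, Matrix.mul_apply]
  refine Finset.sum_congr rfl fun j _ => ?_
  simp only [SimpleGraph.adjMatrix_apply, adjIndicator, G.adj_comm j i]
  split_ifs <;> simp

theorem sum_graphEigenvalues_pow_four :
    ∑ i, graphEigenvalues G i ^ 4 = ∑ i, ∑ j, ∑ k, ∑ l, adjIndicator G i j * adjIndicator G j k *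
      adjIndicator G k l * adjIndicator G l i := by
  classical
  rw [sum_comp_graphEigenvalues G (· ^ 4),
    ← Matrix.IsHermitian.trace_pow_eq_sum_eigenvalues_pow, Matrix.trace]
  refine Finset.sum_congr rfl fun i _ => ?_
  have e : G.adjMatrix ℝ ^ 4 = G.adjMatrix ℝ * (G.adjMatrix ℝ * (G.adjMatrix ℝ * G.adjMatrix ℝ)) := by
    rw [pow_succ', pow_succ', pow_two]
  rw [Matrix.diag_apply, e, Matrix.mul_apply]
  refine Finset.sum_congr rfl fun j _ => ?_
  rw [Matrix.mul_apply, Finset.mul_sum]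
  refine Finset.sum_congr rfl fun k _ => ?_
  rw [Matrix.mul_apply, Finset.mul_sum, Finset.mul_sum]
  refine Finset.sum_congr rfl fun l _ => ?_
  simp only [SimpleGraph.adjMatrix_apply, adjIndicator]
  ring

/-- For the all-ones vector the quadratic form is the sum of the degrees, which is also the trace of
the squared adjacency matrix. -/
theorem exists_le_graphEigenvalues (hn : 0 < n) :
    ∃ i, ∑ i, graphEigenvalues G i ^ 2 ≤ n * graphEigenvalues G i := by
  classical
  have : Nonempty (Fin n) := ⟨⟨0, hn⟩⟩
  obtain ⟨i, hi⟩ := (adjMatrix_isHermitian G).exists_dotProduct_mulVec_le (fun _ => 1)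
  obtain ⟨j, hj⟩ := exists_graphEigenvalues_eq G i
  refine ⟨j, ?_⟩
  rw [sum_graphEigenvalues_sq, hj]
  calc _ = _ := ?_
    _ ≤ _ := hi
    _ = _ := by simp [dotProduct, mul_comm]
  simp [dotProduct, Matrix.mulVec, adjIndicator, SimpleGraph.adjMatrix_apply]

theorem sum_graphEigenvalues_sq_le : ∑ i, graphEigenvalues G i ^ 2 ≤ n ^ 2 := by
  rw [sum_graphEigenvalues_sq]
  calc _ ≤ ∑ i : Fin n, ∑ j : Fin n, (1 : ℝ) :=
        Finset.sum_le_sum fun i _ => Finset.sum_le_sum fun j _ => adjIndicator_le_one G i j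
    _ = _ := by simp [pow_two]

end Graph

/-! ### Expected spectral moments of the random graph. -/

section Random

open SimpleGraph

/-- The event is a cylinder of the product measure. Loops are excluded because `fromEdgeSet`
discards them. -/
theorem SimpleGraph.binomialRandom_real_subset_edgeSet {V : Type*} [Finite V] (p : unitInterval)
    (T : Finset (Sym2 V)) (hT : ∀ e ∈ T, ¬ e.IsDiag) :
    (binomialRandom V p).real {G | (T : Set (Sym2 V)) ⊆ G.edgeSet} = (p : ℝ) ^ T.card := by
  classical
  have hms : MeasurableSet {G : SimpleGraph V | (T : Set (Sym2 V)) ⊆ G.edgeSet} := by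
    have : {G : SimpleGraph V | (T : Set (Sym2 V)) ⊆ G.edgeSet}
        = ⋂ e ∈ T, {G : SimpleGraph V | e ∈ G.edgeSet} := by
      ext G; simp [Set.subset_def]
    rw [this]
    refine Finset.measurableSet_biInter _ fun e _ => ?_
    exact measurable_set_iff.1 measurable_edgeSet e |>.setOf
  rw [measureReal_def, binomialRandom_eq_map, Measure.map_apply measurable_fromEdgeSet hms,
    setBernoulli_apply']
  have : ((fun f : Sym2 V → Prop => {i | f i}) ⁻¹' (fromEdgeSet ⁻¹'
      {G : SimpleGraph V | (T : Set (Sym2 V)) ⊆ G.edgeSet})) = Set.pi T (fun _ => {True}) := by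
    ext f
    simp only [Set.mem_preimage, Set.mem_ofPred_eq, edgeSet_fromEdgeSet, Set.subset_def, Set.mem_pi,
      Set.mem_singleton_iff, eq_iff_iff, iff_true]
    refine forall₂_congr fun e he => ?_
    have := hT e he
    simp [this]
  rw [this, Measure.infinitePi_pi _ (fun _ _ => MeasurableSet.of_discrete)]
  rw [Finset.prod_congr rfl (g := fun _ => ((unitInterval.toNNReal p : NNReal) : ℝ≥0∞))]
  · simp
  · intro e he
    simp [hT e he]


instance SimpleGraph.instDiscreteMeasurableSpace {V : Type*} [Finite V] :
    DiscreteMeasurableSpace (SimpleGraph V) := by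
  classical
  have : MeasurableSingletonClass (SimpleGraph V) := ⟨fun G => by
    have : ({G} : Set (SimpleGraph V)) = Adj ⁻¹' {G.Adj} := by
      ext H; exact SimpleGraph.ext_iff
    rw [this]
    exact measurable_adj (measurableSet_singleton _)⟩
  infer_instance

theorem integral_adjIndicator {V : Type*} [Finite V] (p : unitInterval) {i j : V} (hij : i ≠ j) :
    ∫ G, adjIndicator G i j ∂(binomialRandom V p) = p := by
  classical
  have h := binomialRandom_real_subset_edgeSet p {s(i, j)} (by simpa using hij)
  rw [Finset.card_singleton, pow_one] at h
  rw [← h, ← integral_indicator_one MeasurableSet.of_discrete]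
  congr with G
  simp [adjIndicator, Set.indicator_apply]

theorem integral_adjIndicator_cycle {V : Type*} [Finite V] (p : unitInterval) {i j k l : V}
    (hij : i ≠ j) (hik : i ≠ k) (hil : i ≠ l) (hjk : j ≠ k) (hjl : j ≠ l) (hkl : k ≠ l) :
    ∫ G, adjIndicator G i j * adjIndicator G j k * adjIndicator G k l * adjIndicator G l i
      ∂(binomialRandom V p) = (p : ℝ) ^ 4 := by
  classical
  have h := binomialRandom_real_subset_edgeSet p {s(i, j), s(j, k), s(k, l), s(l, i)}
    (by simp [hij, hjk, hkl, hil.symm])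
  have hc : ({s(i, j), s(j, k), s(k, l), s(l, i)} : Finset (Sym2 V)).card = 4 := by
    rw [Finset.card_insert_of_notMem, Finset.card_insert_of_notMem, Finset.card_insert_of_notMem,
      Finset.card_singleton] <;> simp <;> grind
  rw [hc] at h
  rw [← h, ← integral_indicator_one MeasurableSet.of_discrete]
  congr with G
  by_cases h1 : G.Adj i j <;> by_cases h2 : G.Adj j k <;> by_cases h3 : G.Adj k l <;>
    by_cases h4 : G.Adj l i <;>
    simp [adjIndicator, Set.insert_subset_iff, h1, h2, h3, h4]

/-- If `i ≠ k` and `j ≠ l`, any other coincidence makes a loop and the product vanishes; otherwise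
the four edges are distinct. The two degenerate cases give the `2 n³` in the summed bound. -/
theorem integral_adjIndicator_cycle_le {V : Type*} [Finite V] [DecidableEq V] (p : unitInterval)
    (i j k l : V) :
    ∫ G, adjIndicator G i j * adjIndicator G j k * adjIndicator G k l * adjIndicator G l i
      ∂(binomialRandom V p) ≤ (p : ℝ) ^ 4 + (if i = k then 1 else 0) + (if j = l then 1 else 0) := by
  have hp : 0 ≤ (p : ℝ) ^ 4 := pow_nonneg p.2.1 4
  have hdiag : ∀ (G : SimpleGraph V) (i : V), adjIndicator G i i = 0 := fun G i => by
    simp [adjIndicator]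
  have hle : ∫ G, adjIndicator G i j * adjIndicator G j k * adjIndicator G k l * adjIndicator G l i
      ∂(binomialRandom V p) ≤ 1 := by
    calc _ ≤ ∫ _, (1 : ℝ) ∂(binomialRandom V p) := by
          refine integral_mono .of_finite .of_finite fun G => ?_
          have h := adjIndicator_nonneg G
          have h' := adjIndicator_le_one G
          exact mul_le_one₀ (mul_le_one₀ (mul_le_one₀ (h' _ _) (h _ _) (h' _ _)) (h _ _) (h' _ _))
            (h _ _) (h' _ _)
      _ = 1 := by simp
  by_cases hik : i = k
  · rw [if_pos hik]; split_ifs <;> linarith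
  by_cases hjl : j = l
  · rw [if_pos hjl]; split_ifs; linarith
  rw [if_neg hik, if_neg hjl, add_zero, add_zero]
  by_cases hij : i = j
  · subst hij; simpa [hdiag] using hp
  by_cases hjk : j = k
  · subst hjk; simpa [hdiag] using hp
  by_cases hkl : k = l
  · subst hkl; simpa [hdiag] using hp
  by_cases hil : i = l
  · subst hil; simpa [hdiag] using hp
  exact (integral_adjIndicator_cycle p hij hik hil hjk hjl hkl).le

theorem integral_sum_graphEigenvalues_sq (n : ℕ) (p : unitInterval) :
    ∫ G, ∑ i, graphEigenvalues G i ^ 2 ∂(binomialRandom (Fin n) p) = (n ^ 2 - n) * p := by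
  simp_rw [sum_graphEigenvalues_sq]
  rw [integral_finsetSum _ fun _ _ => .of_finite]
  simp_rw [integral_finsetSum Finset.univ fun j _ => Integrable.of_finite]
  have h : ∀ i j : Fin n, ∫ G, adjIndicator G i j ∂(binomialRandom (Fin n) p)
      = p - if i = j then (p : ℝ) else 0 := by
    intro i j
    by_cases hij : i = j
    · simp [hij, adjIndicator]
    · simp [hij, integral_adjIndicator p hij]
  simp_rw [h, Finset.sum_sub_distrib]
  simp
  ring

theorem integral_sum_graphEigenvalues_pow_four_le (n : ℕ) (p : unitInterval) :
    ∫ G, ∑ i, graphEigenvalues G i ^ 4 ∂(binomialRandom (Fin n) p)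
      ≤ n ^ 4 * (p : ℝ) ^ 4 + 2 * n ^ 3 := by
  simp_rw [sum_graphEigenvalues_pow_four]
  rw [integral_finsetSum _ fun _ _ => .of_finite]
  simp_rw [integral_finsetSum Finset.univ fun j _ => Integrable.of_finite]
  calc _ ≤ ∑ i : Fin n, ∑ j : Fin n, ∑ k : Fin n, ∑ l : Fin n,
        ((p : ℝ) ^ 4 + (if i = k then 1 else 0) + (if j = l then 1 else 0)) := by
        gcongr with i _ j _ k _ l _
        exact integral_adjIndicator_cycle_le p i j k l
    _ = _ := by
        simp [Finset.sum_add_distrib]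
        ring

end Random

/-! ### Conditioning on the graph and passage to the limit. -/

theorem charFun_map_weightedSum {Ω Ω' : Type*} [MeasurableSpace Ω] [MeasurableSpace Ω']
    {P : Measure Ω} [IsProbabilityMeasure P] {P' : Measure Ω'} {X : Ω' → ℝ}
    {n : ℕ} {Y : Fin n → Ω → ℝ} (hYident : ∀ i, IdentDistrib (Y i) X P P') (hY : iIndepFun Y P)
    (a : Fin n → ℝ) (t : ℝ) :
    charFun (P.map fun ω => weightedSum a fun i => Y i ω) t
      = ∏ i, charFun (P'.map X) (t * (a i / n)) := by
  have hYm := fun i => (hYident i).aemeasurable_fst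
  have hZ : iIndepFun (fun i ω => (a i / n) * Y i ω) P :=
    hY.comp (fun i x => (a i / n) * x) fun i => by fun_prop
  have e : (fun ω => weightedSum a fun i => Y i ω) = fun ω => ∑ i, (a i / n) * Y i ω := by
    ext ω
    rw [weightedSum, Finset.mul_sum]
    exact Finset.sum_congr rfl fun i _ => by ring
  rw [e, hZ.charFun_map_fun_sum_eq_prod fun i => by fun_prop, Finset.prod_apply]
  refine Finset.prod_congr rfl fun i _ => ?_
  rw [charFun_map_mul_comp (hYm i), (hYident i).map_eq, mul_comm]

theorem measurable_weightedSum_comp {Γ : Type*} [MeasurableSpace Γ] [Finite Γ]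
    [DiscreteMeasurableSpace Γ] {n : ℕ} (a : Γ → Fin n → ℝ) :
    Measurable fun z : Γ × (Fin n → ℝ) => weightedSum (a z.1) z.2 :=
  measurable_from_prod_countable_right fun g => by unfold weightedSum; fun_prop

theorem aemeasurable_randomWeightedSum {Γ Ω : Type*} [MeasurableSpace Γ] [Finite Γ]
    [DiscreteMeasurableSpace Γ] [MeasurableSpace Ω] {P : Measure Ω} {n : ℕ} {Y : Fin n → Ω → ℝ}
    (hY : ∀ i, AEMeasurable (Y i) P) {G : Ω → Γ} (hG : AEMeasurable G P) (a : Γ → Fin n → ℝ) :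
    AEMeasurable (fun ω => weightedSum (a (G ω)) fun i => Y i ω) P := by
  have h := (measurable_weightedSum_comp a).comp_aemeasurable
    (hG.prodMk (aemeasurable_pi_lambda (fun ω i => Y i ω) hY))
  exact h

/-- By independence the joint law of graph and weights is a product, and Fubini integrates the
weights out first. -/
theorem charFun_map_randomWeightedSum {Γ Ω Ω' : Type*} [MeasurableSpace Γ] [Finite Γ]
    [DiscreteMeasurableSpace Γ] [MeasurableSpace Ω] [MeasurableSpace Ω']
    {P : Measure Ω} [IsProbabilityMeasure P] {P' : Measure Ω'} {X : Ω' → ℝ}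
    {n : ℕ} {Y : Fin n → Ω → ℝ} (hYident : ∀ i, IdentDistrib (Y i) X P P') (hY : iIndepFun Y P)
    {G : Ω → Γ} (hG : AEMeasurable G P) (hGY : IndepFun G (fun ω i => Y i ω) P)
    (a : Γ → Fin n → ℝ) (t : ℝ) :
    charFun (P.map fun ω => weightedSum (a (G ω)) fun i => Y i ω) t
      = ∫ g, ∏ i, charFun (P'.map X) (t * (a g i / n)) ∂(P.map G) := by
  have hYm := fun i => (hYident i).aemeasurable_fst
  have hYv : AEMeasurable (fun ω i => Y i ω) P := aemeasurable_pi_lambda _ hYm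
  have hw := measurable_weightedSum_comp a
  have hprod := (indepFun_iff_map_prod_eq_prod_map_map hG hYv).1 hGY
  have : IsProbabilityMeasure (P.map G) := Measure.isProbabilityMeasure_map hG
  have : IsProbabilityMeasure (P.map fun ω i => Y i ω) := Measure.isProbabilityMeasure_map hYv
  have e : P.map (fun ω => weightedSum (a (G ω)) fun i => Y i ω)
      = ((P.map G).prod (P.map fun ω i => Y i ω)).map fun z => weightedSum (a z.1) z.2 := by
    rw [← hprod, AEMeasurable.map_map_of_aemeasurable hw.aemeasurable (hG.prodMk hYv)]
    rfl
  have hm : ∀ g, Measurable fun y : Fin n → ℝ => weightedSum (a g) y := fun g => by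
    unfold weightedSum; fun_prop
  rw [e, charFun_apply_real, integral_map hw.aemeasurable (by fun_prop), integral_prod]
  · refine integral_congr_ae (ae_of_all _ fun g => ?_)
    simp only
    rw [← charFun_map_weightedSum hYident hY, charFun_apply_real,
      integral_map (φ := fun ω => weightedSum (a g) fun i => Y i ω)
        ((hm g).comp_aemeasurable hYv) (by fun_prop),
      integral_map hYv
        (f := fun y => Complex.exp (t * (weightedSum (a g) y : ℝ) * Complex.I))
        (Measurable.aestronglyMeasurable (by have := hm g; fun_prop))]
  · refine Integrable.of_bound (Measurable.aestronglyMeasurable (by fun_prop)) 1 (ae_of_all _ fun z => ?_)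
    rw [← Complex.ofReal_mul, Complex.norm_exp_ofReal_mul_I]

theorem charFun_map_const_mul_add_gaussian {Ω : Type*} [MeasurableSpace Ω] {P : Measure Ω}
    [IsProbabilityMeasure P] {X N : Ω → ℝ} {c w : ℝ} (hw : 0 ≤ w) (hX : AEMeasurable X P)
    (hN : HasLaw N (gaussianReal 0 w.toNNReal) P) (hXN : IndepFun (fun ω => c * X ω) N P) (t : ℝ) :
    charFun (P.map fun ω => c * X ω + N ω) t
      = charFun (P.map X) (t * c) * (Real.exp (-(w * t ^ 2 / 2)) : ℝ) := by
  rw [hXN.charFun_map_fun_add_eq_mul (by fun_prop) hN.aemeasurable, Pi.mul_apply, hN.map_eq,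
    charFun_map_mul_comp hX, charFun_gaussianReal, Real.coe_toNNReal w hw, mul_comm c]
  congr 1
  push_cast
  congr 1
  simp

theorem tendsto_integral_prod_charFun_graphEigenvalues {p : unitInterval} (hp0 : 0 < p)
    {Ω : Type*} [MeasurableSpace Ω] {P : Measure Ω} [IsProbabilityMeasure P] {X : Ω → ℝ}
    (hsymm : IsSymmetricRV X P) (h4 : MemLp X 4 P) (t : ℝ) :
    Tendsto (fun n : ℕ => ∫ g, ∏ i, charFun (P.map X) (t * (graphEigenvalues g i / n))
        ∂(SimpleGraph.binomialRandom (Fin n) p)) atTop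
      (nhds (charFun (P.map X) (t * p)
        * (Real.exp (-(Var[X; P] * t ^ 2 * ((p : ℝ) - (p : ℝ) ^ 2) / 2)) : ℝ))) := by
  have hXm : AEMeasurable X P := hsymm.aemeasurable_fst
  have : IsProbabilityMeasure (P.map X) := Measure.isProbabilityMeasure_map hXm
  set φ := charFun (P.map X)
  set c := φ (t * p) * (Real.exp (-(Var[X; P] * t ^ 2 * ((p : ℝ) - (p : ℝ) ^ 2) / 2)) : ℝ)
  rw [tendsto_iff_norm_sub_tendsto_zero]
  refine Metric.tendsto_nhds.2 fun ε hε => ?_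
  obtain ⟨L, M, hL, hM, hLM⟩ := exists_norm_prod_sub_le (variance_nonneg X P)
    (by have : 0 ≤ ∫ ω, X ω ^ 4 ∂P := integral_nonneg fun ω => by positivity
        positivity)
    (integral_nonneg fun ω => abs_nonneg (X ω)) (fun s => norm_charFun_le_one s)
    (hsymm.norm_charFun_sub_exp_le h4)
    (norm_charFun_sub_charFun_le (h4.integrable (by norm_num)))
    (show (0 : ℝ) < p from hp0) p.2.2 t (half_pos hε)
  -- The means of `S - p⁴` and `p - D` are at most `2 / n` and exactly `p / n`.
  have hlim : Tendsto (fun n : ℕ => ε / 2 + (2 * L + M * p) * (n : ℝ)⁻¹) atTop (nhds (ε / 2)) := by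
    simpa using (tendsto_inv_atTop_nhds_zero_nat (𝕜 := ℝ)).const_mul (2 * L + M * p)
      |>.const_add (ε / 2)
  filter_upwards [hlim.eventually_lt_const (half_lt_self hε), eventually_gt_atTop 0] with n hn hn0
  rw [dist_zero_right, norm_norm]
  refine lt_of_le_of_lt ?_ hn
  have hn' : (0 : ℝ) < n := by exact_mod_cast hn0
  set μ := SimpleGraph.binomialRandom (Fin n) p
  have hsub : ∫ g, ∏ i, φ (t * (graphEigenvalues g i / n)) ∂μ - c
      = ∫ g, (∏ i, φ (t * (graphEigenvalues g i / n)) - c) ∂μ := by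
    rw [integral_sub .of_finite (integrable_const _)]; simp
  rw [hsub]
  have hpt : ∀ g : SimpleGraph (Fin n), ‖∏ i, φ (t * (graphEigenvalues g i / n)) - c‖
      ≤ ε / 2 + L * ((∑ i, graphEigenvalues g i ^ 4) / n ^ 4 - (p : ℝ) ^ 4)
        + M * (p - (∑ i, graphEigenvalues g i ^ 2) / n ^ 2) := by
    intro g
    obtain ⟨i₀, hi₀⟩ := exists_le_graphEigenvalues g hn0
    have h2 : ∑ i, (graphEigenvalues g i / n) ^ 2 = (∑ i, graphEigenvalues g i ^ 2) / n ^ 2 := by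
      simp_rw [div_pow, Finset.sum_div]
    have h4 : ∑ i, (graphEigenvalues g i / n) ^ 4 = (∑ i, graphEigenvalues g i ^ 4) / n ^ 4 := by
      simp_rw [div_pow, Finset.sum_div]
    have := hLM n (fun i => graphEigenvalues g i / n) i₀
    rw [h2, h4] at this
    refine this ?_ ?_
    · rw [div_le_one (by positivity)]
      exact sum_graphEigenvalues_sq_le g
    · rw [div_le_div_iff₀ (by positivity) hn']
      nlinarith
  -- Since `L ≥ 0`, an upper bound on the mean of `S` is enough.
  refine (norm_integral_le_of_norm_le .of_finite (ae_of_all _ hpt)).trans ?_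
  rw [integral_add .of_finite .of_finite, integral_add .of_finite .of_finite, integral_const_mul,
    integral_const_mul, integral_sub .of_finite .of_finite, integral_sub .of_finite .of_finite,
    integral_div (n ^ 4 : ℝ), integral_div (n ^ 2 : ℝ), integral_sum_graphEigenvalues_sq]
  simp only [integral_const, probReal_univ, smul_eq_mul, one_mul]
  have hS := integral_sum_graphEigenvalues_pow_four_le n p
  have hS' : (∫ g, ∑ i, graphEigenvalues g i ^ 4 ∂μ) / n ^ 4 - (p : ℝ) ^ 4 ≤ 2 * (n : ℝ)⁻¹ := by
    rw [sub_le_iff_le_add, div_le_iff₀ (by positivity)]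
    refine hS.trans_eq ?_
    field_simp
    ring
  have hD : (p : ℝ) - (n ^ 2 - n) * p / n ^ 2 = p * (n : ℝ)⁻¹ := by
    field_simp
    ring
  rw [hD]
  calc _ ≤ ε / 2 + L * (2 * (n : ℝ)⁻¹) + M * (p * (n : ℝ)⁻¹) := by gcongr
    _ = _ := by ring

theorem theorem2
    {p : unitInterval} (hp0 : 0 < p) (hp1 : p < 1) (σ : ℝ)
    -- the limiting random variables `X` and `N`
    {Ω' : Type*} [MeasurableSpace Ω'] (P' : Measure Ω') [IsProbabilityMeasure P']
    (X N : Ω' → ℝ)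
    (hXsymm : IsSymmetricRV X P') (hXsub : IsSubGaussian X P') (hXvar : Var[X; P'] = σ ^ 2)
    (hN : HasLaw N (gaussianReal 0 (Real.toNNReal ((p : ℝ) * (1 - (p : ℝ)) * σ ^ 2))) P')
    (hXN : IndepFun (fun ω => (p : ℝ) * X ω) N P')
    -- for each `n`: a random graph `G n` and i.i.d. copies of `X` that are independent of it
    {Ω : ℕ → Type*} [∀ n, MeasurableSpace (Ω n)] (P : ∀ n, Measure (Ω n))
    [∀ n, IsProbabilityMeasure (P n)]
    (G : ∀ n, Ω n → SimpleGraph (Fin n))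
    (hG : ∀ n, HasLaw (G n) (SimpleGraph.binomialRandom (Fin n) p) (P n))
    (Y : ∀ n, Fin n → Ω n → ℝ)
    (hYident : ∀ n i, IdentDistrib (Y n i) X (P n) P')
    (hYindep : ∀ n, iIndepFun (Y n) (P n))
    (hGY : ∀ n, IndepFun (G n) (fun ω i => Y n i ω) (P n)) :
    TendstoInDistribution
      (fun n ω => weightedSum (graphEigenvalues (G n ω)) (fun i => Y n i ω)) atTop
      (fun ω => (p : ℝ) * X ω + N ω) P P' := by
  have hXm : AEMeasurable X P' := hXsymm.aemeasurable_fst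
  have hNm : AEMeasurable N P' := hN.aemeasurable
  have hW : ∀ n, AEMeasurable
      (fun ω => weightedSum (graphEigenvalues (G n ω)) (fun i => Y n i ω)) (P n) := fun n =>
    aemeasurable_randomWeightedSum (fun i => (hYident n i).aemeasurable_fst) (hG n).aemeasurable
      graphEigenvalues
  have hw : 0 ≤ (p : ℝ) * (1 - (p : ℝ)) * σ ^ 2 :=
    mul_nonneg (mul_nonneg p.2.1 (sub_nonneg.2 p.2.2)) (sq_nonneg σ)
  have hchar : ∀ t, Tendsto (fun n => charFun ((P n).map fun ω =>
      weightedSum (graphEigenvalues (G n ω)) (fun i => Y n i ω)) t) atTop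
      (nhds (charFun (P'.map fun ω => (p : ℝ) * X ω + N ω) t)) := by
    intro t
    have hlim := tendsto_integral_prod_charFun_graphEigenvalues hp0 hXsymm hXsub.memLp_four t
    rw [charFun_map_const_mul_add_gaussian hw hXm hN hXN]
    have e : (p : ℝ) * (1 - (p : ℝ)) * σ ^ 2 * t ^ 2 / 2
        = Var[X; P'] * t ^ 2 * ((p : ℝ) - (p : ℝ) ^ 2) / 2 := by rw [hXvar]; ring
    rw [e]
    refine hlim.congr fun n => ?_
    rw [charFun_map_randomWeightedSum (hYident n) (hYindep n) (hG n).aemeasurable (hGY n)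
      graphEigenvalues, (hG n).map_eq]
  exact ⟨hW, by fun_prop, ProbabilityMeasure.tendsto_iff_tendsto_charFun.2 hchar⟩
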